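/- **The Schori solenoid.** Let $\overline X_0$ be the compact surface made of two cut $1$-handles $H$ and $F$ as follows: each is an annulus $[0,1]\times\mathbb R/\mathbb Z$ without an open disc, and the two are glued along the boundary circles of the removed discs. Gluing the two ends $\{1\}\times\mathbb R/\mathbb Z$ and $\{0\}\times\mathbb R/\mathbb Z$ of each handle gives the closed genus two surface $X_0$, with closed curves $C_0\subset H$ and $D_0\subset F$ (the cuts). Inductively, given $X_\ell$, made of $3^\ell$ copies of $\overline X_0$, with curves $C_\ell$ and $D_\ell$, each a lift of $C_0$, respectively $D_0$, cut $X_\ell$ along $C_\ell$ and $D_\ell$, take three copies numbered $0,1,2$ of the resulting surface, and reglue them: along $C_\ell$ copies $0$ and $1$ are joined crosswise (each side of the cut in one copy is glued to the opposite side in the other copy) and copy $2$ is closed up; along $D_\ell$ copies $1$ and $2$ are joined crosswise and copy $0$ is closed up. This gives a surface $X_{\ell+1}$ and a $3$-to-$1$ covering map $X_{\ell+1}\to X_\ell$. The next curve $C_{\ell+1}$ (respectively $D_{\ell+1}$) is any lift of $C_0$ (respectively $D_0$) which crosses the longer handle formed by joining two copies crosswise along $C_\ell$ (respectively $D_\ell$).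 A Schori solenoid is $\mathcal S=\varprojlim X_\ell\subset\prod_\ell X_\ell$, for any such choice of curves. **Holonomy.** Fix $x_0\in X_0$, let $G_0=\pi_1(X_0,x_0)$ and let $\mathfrak X_0\subset\mathcal S$ be the fibre over $x_0$. For $g=[\gamma]\in G_0$ and $y=(y_\ell)\in\mathfrak X_0$ put $\Phi_0(g)(y)=(\gamma_\ell(1))_\ell$, where $\gamma_\ell$ is the lift of $\gamma$ to $X_\ell$ with $\gamma_\ell(0)=y_\ell$; this is an action of $G_0$ on $\mathfrak X_0$ by homeomorphisms. For $y\in\mathfrak X_0$ and $n\ge 0$ let $U_n^y=\{z\in\mathfrak X_0 : z_n=y_n\}$, let $G_n^y\subset G_0$ be the image of $\pi_1(X_n,y_n)$, and let $\Phi_n$ be the restricted action of $G_n^y$ on $U_n^y$. **SQA.** A family of homeomorphisms between open subsets of a space is strongly quasi-analytic (SQA) if each of its elements that is the identity on some non-empty open subset of its domain is the identity on its whole domain. An action by homeomorphisms is SQA if the family of all restrictions of its elements to open sets is SQA. **Theorem.** Let $\mathcal S$ be a Schori solenoid and $x_0\in X_0$. For every basepoint $y\in\mathfrak X_0$ and every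 $n\ge 0$, the holonomy action $(U_n^y,G_n^y,\Phi_n)$ is not SQA. Moreover there are $g\in G_n^y$ and pairwise disjoint non-empty clopen sets $A,B,C\subset U_n^y$ such that $\Phi_n(g)$ is the identity on $A$, $\Phi_n(g)(B)=C$ and $\Phi_n(g)(C)=B$. Also, for every non-empty clopen set $V\subset\mathfrak X_0$, the induced holonomy pseudo$\star$group on $V$ (all restrictions of the maps $\Phi_0(g)$, $g\in G_0$, to open sets $O\subset V$ with $\Phi_0(g)(O)\subset V$) is not SQA. -/

import Mathlib

open Set Topology

/-! ### Strongly quasi-analytic actions -/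

/-- The collection of all restrictions to open sets of the homeomorphisms `Φ g`, `g ∈ G`. -/
def pseudoStarGroup {G T : Type*} [Group G] [TopologicalSpace T] (Φ : G →* (T ≃ₜ T)) :
    Set (OpenPartialHomeomorph T T) :=
  {h | ∃ g : G, EqOn h (Φ g) h.source}

/-- The members of a family of local homeomorphisms with domain and range in `V`. -/
def inducedOn {T : Type*} [TopologicalSpace T] (𝒢 : Set (OpenPartialHomeomorph T T))
    (V : Set T) : Set (OpenPartialHomeomorph T T) :=
  {h | h ∈ 𝒢 ∧ h.source ⊆ V ∧ h.target ⊆ V}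

/-- Strong quasi-analyticity (SQA): an element which is the identity on a non-empty open subset
of its domain is the identity on its whole domain. -/
def IsSQA {T : Type*} [TopologicalSpace T] (𝒢 : Set (OpenPartialHomeomorph T T)) : Prop :=
  ∀ h ∈ 𝒢, ∀ U : Set T, IsOpen U → U.Nonempty → U ⊆ h.source → EqOn h id U → EqOn h id h.source

/-! ### Towers of coverings, their inverse limits, and the holonomy action -/

/-- A presentation: a sequence of covering maps `p ℓ : M (ℓ + 1) → M ℓ`. -/
structure Presentation where
  M : ℕ → Type
  [top : ∀ ℓ, TopologicalSpace (M ℓ)]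
  p : ∀ ℓ, M (ℓ + 1) → M ℓ
  cov : ∀ ℓ, IsCoveringMap (p ℓ)

namespace Presentation

attribute [instance] Presentation.top

variable (P : Presentation)

/-- The inverse limit of the tower, with the topology induced from the product. -/
abbrev Solenoid : Type := {z : ∀ ℓ, P.M ℓ // ∀ ℓ, P.p ℓ (z (ℓ + 1)) = z ℓ}

/-- The fibre over `x₀` of the projection of the inverse limit to `M 0`. -/
abbrev Fiber (x₀ : P.M 0) : Type := {z : P.Solenoid // z.1 0 = x₀}

/-- The composite covering `q n = p 0 ∘ ⋯ ∘ p (n - 1) : M n → M 0`. -/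
def q : ∀ n, C(P.M n, P.M 0)
  | 0 => ContinuousMap.id _
  | n + 1 => (q n).comp ⟨P.p n, (P.cov n).continuous⟩

lemma q_apply (z : P.Solenoid) : ∀ n, P.q n (z.1 n) = z.1 0
  | 0 => rfl
  | n + 1 => (congrArg (P.q n) (z.2 n)).trans (q_apply z n)

variable {P}

/-- The successive lifts of a path `γ` in `M 0`, the one in `M ℓ` starting at `z ℓ`. -/
noncomputable def lift (z : P.Solenoid) (γ : C(unitInterval, P.M 0)) (h : γ 0 = z.1 0) :
    ∀ ℓ, {Γ : C(unitInterval, P.M ℓ) // Γ 0 = z.1 ℓ}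
  | 0 => ⟨γ, h⟩
  | ℓ + 1 => ⟨(P.cov ℓ).liftPath (lift z γ h ℓ).1 (z.1 (ℓ + 1))
      ((lift z γ h ℓ).2.trans (z.2 ℓ).symm), (P.cov ℓ).liftPath_zero _ _ _⟩

lemma p_lift (z : P.Solenoid) (γ : C(unitInterval, P.M 0)) (h : γ 0 = z.1 0) (ℓ : ℕ) (t : unitInterval) :
    P.p ℓ ((lift z γ h (ℓ + 1)).1 t) = (lift z γ h ℓ).1 t :=
  congrFun ((P.cov ℓ).liftPath_lifts (lift z γ h ℓ).1 (z.1 (ℓ + 1))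
    ((lift z γ h ℓ).2.trans (z.2 ℓ).symm)) t

lemma lift_unique (z : P.Solenoid) (γ : C(unitInterval, P.M 0)) (h : γ 0 = z.1 0) : ∀ (n : ℕ)
    (δ : C(unitInterval, P.M n)), (P.q n).comp δ = γ → δ 0 = z.1 n → (lift z γ h n).1 = δ
  | 0, _, hδ, _ => hδ.symm
  | n + 1, δ, hδ, h0 => by
      have ih := lift_unique z γ h n (ContinuousMap.comp ⟨P.p n, (P.cov n).continuous⟩ δ)
        (by rw [← hδ]; rfl) (by rw [← z.2 n, ← h0]; rfl)
      refine ((P.cov n).eq_liftPath_iff'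
        ((lift z γ h n).2.trans (z.2 n).symm) |>.mpr ⟨?_, h0⟩).symm
      rw [ih]; rfl

lemma q_lift (z : P.Solenoid) (γ : C(unitInterval, P.M 0)) (h : γ 0 = z.1 0) :
    ∀ n, (P.q n).comp (lift z γ h n).1 = γ
  | 0 => rfl
  | n + 1 => by
      have ih := q_lift z γ h n
      ext t
      exact (congrArg (P.q n) (p_lift z γ h n t)).trans (congrArg (fun f : C(unitInterval, P.M 0) => f t) ih)

lemma lift_homotopic (z : P.Solenoid) {γ γ' : C(unitInterval, P.M 0)} (h : γ 0 = z.1 0) (h' : γ' 0 = z.1 0)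
    (H : γ.HomotopicRel γ' {0, 1}) : ∀ ℓ, (lift z γ h ℓ).1.HomotopicRel (lift z γ' h' ℓ).1 {0, 1}
  | 0 => H
  | ℓ + 1 => (P.cov ℓ).homotopicRel_liftPath (lift_homotopic z h h' H ℓ) _
      ((lift z γ h ℓ).2.trans (z.2 ℓ).symm) ((lift z γ' h' ℓ).2.trans (z.2 ℓ).symm)

lemma coord_eq_of_le {z z' : P.Solenoid} {ℓ : ℕ} (h : z.1 ℓ = z'.1 ℓ) {j : ℕ} (hj : j ≤ ℓ) :
    z.1 j = z'.1 j := by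
  induction hj with
  | refl => exact h
  | step _ ih => exact ih (by rw [← z.2, ← z'.2, h])

variable {x₀ : P.M 0}

/-- The endpoint of the lift of the loop `γ` which starts at `z`. -/
noncomputable def transport (γ : Path x₀ x₀) (z : P.Fiber x₀) : P.Fiber x₀ :=
  ⟨⟨fun ℓ => (lift z.1 γ (γ.source.trans z.2.symm) ℓ).1 1, fun ℓ => p_lift _ _ _ ℓ 1⟩, γ.target⟩

lemma transport_homotopic {γ γ' : Path x₀ x₀} (H : γ.Homotopic γ') (z : P.Fiber x₀) :
    transport γ z = transport γ' z := by
  refine Subtype.ext (Subtype.ext (funext fun ℓ => ?_))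
  have K := (lift_homotopic z.1 (γ.source.trans z.2.symm) (γ'.source.trans z.2.symm) H ℓ).some
  exact (K.eq_fst 0 (.inr rfl)).symm.trans (K.eq_snd 0 (.inr rfl))

/-- The map `h_g` of the fibre given by the homotopy class `g` of a loop. -/
noncomputable def holonomyMap (g : FundamentalGroup (P.M 0) x₀) (z : P.Fiber x₀) : P.Fiber x₀ :=
  Quotient.lift (fun γ : Path x₀ x₀ => transport γ z) (fun _ _ H => transport_homotopic H z) g

lemma holonomyMap_one (z : P.Fiber x₀) : holonomyMap 1 z = z := by
  refine Subtype.ext (Subtype.ext (funext fun ℓ => ?_))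
  have := lift_unique z.1 (Path.refl x₀ : C(unitInterval, P.M 0)) z.2.symm ℓ (.const _ (z.1.1 ℓ))
    (by ext t; exact (P.q_apply z.1 ℓ).trans z.2) rfl
  exact congrArg (fun f : C(unitInterval, P.M ℓ) => f 1) this

lemma transport_trans (γ γ' : Path x₀ x₀) (z : P.Fiber x₀) :
    transport (γ.trans γ') z = transport γ' (transport γ z) := by
  refine Subtype.ext (Subtype.ext (funext fun ℓ => ?_))
  have h := γ.source.trans z.2.symm
  let w := transport γ z
  have h' := γ'.source.trans w.2.symm
  let a : Path (z.1.1 ℓ) (w.1.1 ℓ) := ⟨(lift z.1 γ h ℓ).1, (lift z.1 γ h ℓ).2, rfl⟩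
  let b : Path (w.1.1 ℓ) ((transport γ' w).1.1 ℓ) :=
    ⟨(lift w.1 γ' h' ℓ).1, (lift w.1 γ' h' ℓ).2, rfl⟩
  have := lift_unique z.1 (γ.trans γ' : C(unitInterval, P.M 0)) ((γ.trans γ').source.trans z.2.symm) ℓ
    (a.trans b : C(unitInterval, P.M ℓ)) (by
      ext t
      change P.q ℓ ((a.trans b) t) = (γ.trans γ') t
      rw [Path.trans_apply, Path.trans_apply]
      split_ifs
      · exact congrArg (fun f : C(unitInterval, P.M 0) => f _) (q_lift z.1 γ h ℓ)
      · exact congrArg (fun f : C(unitInterval, P.M 0) => f _) (q_lift w.1 γ' h' ℓ))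
    (a.trans b).source
  exact (congrArg (fun f : C(unitInterval, P.M ℓ) => f 1) this).trans (a.trans b).target

lemma holonomyMap_mul (g g' : FundamentalGroup (P.M 0) x₀) (z : P.Fiber x₀) :
    holonomyMap (g * g') z = holonomyMap g (holonomyMap g' z) := by
  induction g using Quotient.inductionOn with | _ γ
  induction g' using Quotient.inductionOn with | _ γ'
  exact transport_trans γ' γ z

/-- The cylinder `{z | z n = y n}` in the fibre, i.e. the transverse section `U n y`. -/
def cylinder (y : P.Fiber x₀) (n : ℕ) : Set (P.Fiber x₀) := {z | z.1.1 n = y.1.1 n}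

lemma isOpen_cylinder (y : P.Fiber x₀) : ∀ n, IsOpen (cylinder y n)
  | 0 => by
      convert isOpen_univ
      exact eq_univ_of_forall fun z => z.2.trans y.2.symm
  | n + 1 => by
      obtain ⟨e, he, hpe⟩ := (P.cov n).isLocalHomeomorph (y.1.1 (n + 1))
      have : cylinder y (n + 1) =
          cylinder y n ∩ (fun z : P.Fiber x₀ => z.1.1 (n + 1)) ⁻¹' e.source := by
        ext z
        refine ⟨fun hz => ⟨coord_eq_of_le hz n.le_succ, ?_⟩, fun hz => e.injOn hz.2 he ?_⟩
        · change z.1.1 (n + 1) ∈ e.source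
          rwa [show z.1.1 (n + 1) = _ from hz]
        · rw [← hpe, z.1.2, y.1.2]; exact hz.1
      rw [this]
      exact (isOpen_cylinder y n).inter (e.open_source.preimage
        ((continuous_apply _).comp (continuous_subtype_val.comp continuous_subtype_val)))

lemma lift_congr {z z' : P.Solenoid} (γ : C(unitInterval, P.M 0)) (h : γ 0 = z.1 0) (h' : γ 0 = z'.1 0)
    {ℓ : ℕ} (hz : z'.1 ℓ = z.1 ℓ) : (lift z γ h ℓ).1 = (lift z' γ h' ℓ).1 :=
  lift_unique z γ h ℓ _ (q_lift z' γ h' ℓ) ((lift z' γ h' ℓ).2.trans hz)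

lemma continuous_transport (γ : Path x₀ x₀) : Continuous (transport (P := P) γ) := by
  refine Continuous.subtype_mk (Continuous.subtype_mk (continuous_pi fun ℓ => ?_) _) _
  refine continuous_iff_continuousAt.mpr fun z => ?_
  refine (continuousAt_const (y := (transport γ z).1.1 ℓ)).congr (Filter.eventually_of_mem
    ((isOpen_cylinder z ℓ).mem_nhds rfl) fun z' hz' => ?_)
  exact congrArg (fun f : C(unitInterval, P.M ℓ) => f 1) (lift_congr γ _ _ hz')

lemma continuous_holonomyMap (g : FundamentalGroup (P.M 0) x₀) :
    Continuous (holonomyMap (P := P) g) := by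
  induction g using Quotient.inductionOn with | _ γ
  exact continuous_transport γ

/-- The global holonomy action `π₁(M 0, x₀) → Homeo(𝔛₀)` on the fibre over `x₀`. -/
noncomputable def holonomy (x₀ : P.M 0) :
    FundamentalGroup (P.M 0) x₀ →* (P.Fiber x₀ ≃ₜ P.Fiber x₀) where
  toFun g :=
    { toFun := holonomyMap g
      invFun := holonomyMap g⁻¹
      left_inv := fun z => by rw [← holonomyMap_mul, inv_mul_cancel, holonomyMap_one]
      right_inv := fun z => by rw [← holonomyMap_mul, mul_inv_cancel, holonomyMap_one]
      continuous_toFun := continuous_holonomyMap g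
      continuous_invFun := continuous_holonomyMap g⁻¹ }
  map_one' := Homeomorph.ext holonomyMap_one
  map_mul' g g' := Homeomorph.ext (holonomyMap_mul g g')

/-- The group `G n y`: the image of `π₁(M n, y n)` in `π₁(M 0, x₀)` under `q n`. -/
noncomputable def chainGroup (y : P.Fiber x₀) (n : ℕ) : Subgroup (FundamentalGroup (P.M 0) x₀) :=
  (FundamentalGroup.mapOfEq (P.q n) ((P.q_apply y.1 n).trans y.2)).range

lemma holonomyMap_mem_cylinder (y : P.Fiber x₀) (n : ℕ) {g : FundamentalGroup (P.M 0) x₀}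
    (hg : g ∈ chainGroup y n) {z : P.Fiber x₀} (hz : z ∈ cylinder y n) :
    holonomyMap g z ∈ cylinder y n := by
  obtain ⟨a, rfl⟩ := hg
  rw [FundamentalGroup.mapOfEq_apply]
  induction a using Quotient.inductionOn with | _ γ
  have e := (P.q_apply y.1 n).trans y.2
  have := lift_unique z.1 (((γ.map (P.q n).continuous).cast e.symm e.symm : Path x₀ x₀) :
    C(unitInterval, P.M 0)) (by rw [z.2]; exact Path.source _) n (γ : C(unitInterval, P.M n))
    (by ext t; rfl) (γ.source.trans hz.symm)
  exact (congrArg (fun f : C(unitInterval, P.M n) => f 1) this).trans γ.target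

/-- The holonomy action of `G n y` on the transverse section `U n y`. -/
noncomputable def sectionHolonomy (y : P.Fiber x₀) (n : ℕ) :
    chainGroup y n →* (cylinder y n ≃ₜ cylinder y n) where
  toFun g :=
    { toFun := fun z => ⟨holonomy x₀ g z, holonomyMap_mem_cylinder y n g.2 z.2⟩
      invFun := fun z => ⟨holonomy x₀ (g⁻¹ : chainGroup y n) z,
        holonomyMap_mem_cylinder y n (g⁻¹).2 z.2⟩
      left_inv := fun z => Subtype.ext (by simp)
      right_inv := fun z => Subtype.ext (by simp)
      continuous_toFun := by fun_prop
      continuous_invFun := by fun_prop }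
  map_one' := Homeomorph.ext fun z => Subtype.ext (holonomyMap_one z.1)
  map_mul' g g' := Homeomorph.ext fun z => Subtype.ext (holonomyMap_mul g.1 g'.1 z.1)

end Presentation

/-! ### Surfaces glued from cut handles -/

/-- The two handles of the genus two surface. -/
inductive Handle
  | H
  | F

/-- A handle (a torus without an open disc), cut along a closed curve: the annulus
`[0,1] × ℝ/ℤ` without the open disc `|t - 1/2| < 1/4`, `‖θ‖ < 1/4`. -/
abbrev CutHandle : Type :=
  {a : unitInterval × UnitAddCircle // 1 / 4 ≤ max |(a.1 : ℝ) - 1 / 2| ‖a.2‖}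

namespace CutHandle

/-- The boundary circle of the removed disc. -/
def OnRim (a : CutHandle) : Prop := max |(a.1.1 : ℝ) - 1 / 2| ‖a.1.2‖ = 1 / 4

/-- One side `t = 1` of the cut. -/
def outgoing (θ : UnitAddCircle) : CutHandle :=
  ⟨(1, θ), le_max_of_le_left (by norm_num [abs_of_pos])⟩

/-- The other side `t = 0` of the cut. -/
def incoming (θ : UnitAddCircle) : CutHandle :=
  ⟨(0, θ), le_max_of_le_left (by norm_num [abs_of_neg])⟩

end CutHandle

/-- Gluing rules for `W`-indexed copies of the two cut handles.  In each copy the handles `H`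
and `F` are glued along their rims, which gives a copy of the genus two surface cut along two
curves; the side `t = 1` of the cut of the handle `k` in copy `w` is glued to the
side `t = 0` of the cut of the handle `k` in copy `σ k w`. -/
inductive Glue {W : Type} (σ : Handle → Equiv.Perm W) :
    (Σ _ : Handle × W, CutHandle) → (Σ _ : Handle × W, CutHandle) → Prop
  | rim (w : W) (a : CutHandle) (ha : a.OnRim) : Glue σ ⟨(.H, w), a⟩ ⟨(.F, w), a⟩
  | seam (k : Handle) (w : W) (θ : UnitAddCircle) :
      Glue σ ⟨(k, w), CutHandle.outgoing θ⟩ ⟨(k, σ k w), CutHandle.incoming θ⟩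

/-- The closed surface glued from `W`-indexed copies of the cut genus two surface. -/
def Surface {W : Type} (σ : Handle → Equiv.Perm W) : Type := Quot (Glue σ)

namespace Surface

instance {W : Type} (σ : Handle → Equiv.Perm W) : TopologicalSpace (Surface σ) :=
  inferInstanceAs (TopologicalSpace (Quot _))

/-- The map of surfaces induced by an equivariant map of index sets. -/
def map {W V : Type} {σ : Handle → Equiv.Perm W} {τ : Handle → Equiv.Perm V} (f : W → V)
    (hf : ∀ k w, f (σ k w) = τ k (f w)) : Surface σ → Surface τ :=
  Quot.map (fun x => ⟨(x.1.1, f x.1.2), x.2⟩) (by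
    rintro _ _ (⟨w, a, ha⟩ | ⟨k, w, θ⟩)
    · exact .rim (f w) a ha
    · simpa [hf] using Glue.seam (σ := τ) k (f w) θ)

section Covering

/-- A region of the cut handles over which the glued surfaces have a locally constant label:
over `lo` the label of a point is the index of its copy, and over `hi` it is the index of the copy
on the other side of the cut. -/
structure Region where
  lo : Handle → Set CutHandle
  hi : Handle → Set CutHandle
  lo_open : ∀ k, IsOpen (lo k)
  hi_open : ∀ k, IsOpen (hi k)
  disj : ∀ k a, a ∈ lo k → a ∉ hi k
  rim_lo : ∀ a : CutHandle, a.OnRim → (a ∈ lo .H ↔ a ∈ lo .F)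
  rim_hi : ∀ a : CutHandle, a.OnRim → ∀ k, a ∉ hi k
  seam_hi : ∀ k θ, CutHandle.outgoing θ ∉ lo k
  seam_lo : ∀ k θ, CutHandle.incoming θ ∉ hi k
  seam_iff : ∀ k θ, CutHandle.outgoing θ ∈ hi k ↔ CutHandle.incoming θ ∈ lo k

variable {W V : Type} {σ : Handle → Equiv.Perm W} {τ : Handle → Equiv.Perm V}

/-- The part of the region in the glued surface where the label is `w`. -/
def Region.sheet (R : Region) (σ : Handle → Equiv.Perm W) (w : W) : Set (Surface σ) :=
  {z | Quot.lift (fun x : Σ _ : Handle × W, CutHandle =>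
      (x.2 ∈ R.lo x.1.1 ∧ x.1.2 = w) ∨ (x.2 ∈ R.hi x.1.1 ∧ σ x.1.1 x.1.2 = w)) (by
    rintro _ _ (⟨w, a, ha⟩ | ⟨k, w, θ⟩)
    · simp [R.rim_lo a ha, R.rim_hi a ha]
    · simp [R.seam_hi, R.seam_lo, R.seam_iff]) z}

open Classical in
/-- The sheet with label `w`, as a (partial) section. -/
noncomputable def Region.sec [Nonempty (Surface σ)] (R : Region) (τ : Handle → Equiv.Perm V)
    (w : W) : Surface τ → Surface σ :=
  Quot.lift (fun x : Σ _ : Handle × V, CutHandle =>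
      if x.2 ∈ R.lo x.1.1 then Quot.mk _ ⟨(x.1.1, w), x.2⟩
      else if x.2 ∈ R.hi x.1.1 then Quot.mk _ ⟨(x.1.1, (σ x.1.1).symm w), x.2⟩
      else Classical.arbitrary (Surface σ)) (by
    rintro _ _ (⟨v, a, ha⟩ | ⟨k, v, θ⟩)
    · by_cases h : a ∈ R.lo .H
      · exact (if_pos h).trans ((Quot.sound (.rim w a ha)).trans
          (if_pos ((R.rim_lo a ha).mp h)).symm)
      · exact ((if_neg h).trans (if_neg (R.rim_hi a ha _))).trans
          ((if_neg (h ∘ (R.rim_lo a ha).mpr)).trans (if_neg (R.rim_hi a ha _))).symm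
    · refine (if_neg (R.seam_hi k θ)).trans ?_
      by_cases h : CutHandle.outgoing θ ∈ R.hi k
      · refine (if_pos h).trans (Eq.trans ?_ (if_pos ((R.seam_iff k θ).mp h)).symm)
        exact Quot.sound (by simpa using Glue.seam (σ := σ) k ((σ k).symm w) θ)
      · exact (if_neg h).trans ((if_neg (h ∘ (R.seam_iff k θ).mpr)).trans
          (if_neg (R.seam_lo k θ))).symm)

lemma isOpen_iff {s : Set (Surface σ)} :
    IsOpen s ↔ ∀ k w, IsOpen {a : CutHandle | (Quot.mk _ ⟨(k, w), a⟩ : Surface σ) ∈ s} := by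
  refine (isOpen_coinduced (f := Quot.mk (Glue σ)) (s := s)).trans (isOpen_sigma_iff.trans ?_)
  exact ⟨fun h k w => h (k, w), fun h x => h x.1 x.2⟩

lemma Region.isOpen_sheet (R : Region) (w : W) : IsOpen (R.sheet σ w) := by
  refine isOpen_iff.mpr fun k u => ?_
  exact ((R.lo_open k).inter (isOpen_const (p := u = w))).union
    ((R.hi_open k).inter (isOpen_const (p := σ k u = w)))

lemma Region.isEvenlyCovered (R : Region) (f : W → V) (hf : ∀ k w, f (σ k w) = τ k (f w))
    (hs : Function.Surjective f) (v : V) (x : Surface τ) (hx : x ∈ R.sheet τ v) :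
    IsEvenlyCovered (map f hf) x (map f hf ⁻¹' {x}) := by
  obtain ⟨w₀, hw₀⟩ := hs v
  have hf' : ∀ k w, f ((σ k).symm w) = (τ k).symm (f w) := fun k w => by
    rw [Equiv.eq_symm_apply, ← hf, Equiv.apply_symm_apply]
  have hne : Nonempty (Surface σ) := by
    obtain ⟨⟨⟨k, _⟩, a⟩⟩ := x
    exact ⟨Quot.mk _ ⟨(k, w₀), a⟩⟩
  have left : ∀ w, ∀ z ∈ R.sheet σ w, R.sec (σ := σ) τ w (map f hf z) = z := by
    rintro w ⟨⟨⟨k, u⟩, a⟩⟩ (⟨h, rfl⟩ | ⟨h, rfl⟩)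
    · exact if_pos h
    · refine (if_neg fun h' => R.disj k a h' h).trans ((if_pos h).trans ?_)
      simp only [Equiv.symm_apply_apply]; rfl
  let ι := {w : W // f w = v}
  have : Nonempty ι := ⟨⟨w₀, hw₀⟩⟩
  let _ : TopologicalSpace ι := ⊥
  have : DiscreteTopology ι := ⟨rfl⟩
  have : Nonempty (Surface τ → Surface σ) := ⟨fun _ => hne.some⟩
  refine (IsEvenlyCovered.of_trivialization (t := IsOpen.trivializationDiscrete (ι := ι)
    (fun w => R.sheet σ w.1) (R.sheet τ v) (R.isOpen_sheet v) (f := map f hf)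
    ?_ ?_ ?_ ?_ ?_) hx).to_isEvenlyCovered_preimage
  · rintro ⟨w, hw⟩ O hO
    rw [isOpen_iff, isOpen_iff]
    constructor
    · intro h k u
      exact (h k (f u)).inter (isOpen_iff.mp (R.isOpen_sheet w) k u)
    · intro h k u
      have key : {a : CutHandle | (Quot.mk _ ⟨(k, u), a⟩ : Surface τ) ∈ O} =
          (({a | (Quot.mk _ ⟨(k, w), a⟩ : Surface σ) ∈ map f hf ⁻¹' O ∩ R.sheet σ w} ∩ R.lo k) ∩
            {_a | u = v}) ∪
          (({a | (Quot.mk _ ⟨(k, (σ k).symm w), a⟩ : Surface σ) ∈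
            map f hf ⁻¹' O ∩ R.sheet σ w} ∩ R.hi k) ∩ {_a | τ k u = v}) := by
        ext a
        constructor
        · intro ha
          rcases hO ha with ⟨h1, h2⟩ | ⟨h1, h2⟩
          · refine .inl ⟨⟨⟨?_, .inl ⟨h1, rfl⟩⟩, h1⟩, h2⟩
            change (Quot.mk _ ⟨(k, f w), a⟩ : Surface τ) ∈ O
            rw [hw, ← show u = v from h2]; exact ha
          · refine .inr ⟨⟨⟨?_, .inr ⟨h1, by simp⟩⟩, h1⟩, h2⟩
            change (Quot.mk _ ⟨(k, f ((σ k).symm w)), a⟩ : Surface τ) ∈ O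
            rw [hf', hw, ← show τ k u = v from h2, Equiv.symm_apply_apply]; exact ha
        · rintro (⟨⟨⟨h1, _⟩, _⟩, h2⟩ | ⟨⟨⟨h1, _⟩, _⟩, h2⟩)
          · change (Quot.mk _ ⟨(k, f w), a⟩ : Surface τ) ∈ O at h1
            rw [hw, ← show u = v from h2] at h1; exact h1
          · change (Quot.mk _ ⟨(k, f ((σ k).symm w)), a⟩ : Surface τ) ∈ O at h1
            rw [hf', hw, ← show τ k u = v from h2, Equiv.symm_apply_apply] at h1; exact h1
      rw [key]
      exact (((h k w).inter (R.lo_open k)).inter isOpen_const).union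
        (((h k _).inter (R.hi_open k)).inter isOpen_const)
  · intro w z hz z' hz' e
    rw [← left w z hz, e, left w z' hz']
  · rintro ⟨w, hw⟩ ⟨⟨⟨k, u⟩, a⟩⟩ (⟨h1, h2⟩ | ⟨h1, h2⟩)
    · refine ⟨Quot.mk _ ⟨(k, w), a⟩, .inl ⟨h1, rfl⟩, ?_⟩
      change (Quot.mk _ ⟨(k, f w), a⟩ : Surface τ) = _
      rw [hw, ← show u = v from h2]
    · refine ⟨Quot.mk _ ⟨(k, (σ k).symm w), a⟩, .inr ⟨h1, by simp⟩, ?_⟩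
      change (Quot.mk _ ⟨(k, f ((σ k).symm w)), a⟩ : Surface τ) = _
      rw [hf', hw, ← show τ k u = v from h2, Equiv.symm_apply_apply]
  · rintro ⟨w, hw⟩ ⟨w', hw'⟩ hne
    refine Set.disjoint_left.mpr ?_
    rintro ⟨⟨⟨k, u⟩, a⟩⟩ (⟨h1, h2⟩ | ⟨h1, h2⟩) (⟨h3, h4⟩ | ⟨h3, h4⟩)
    · exact hne (Subtype.ext (h2.symm.trans h4))
    · exact R.disj k a h1 h3
    · exact R.disj k a h3 h1
    · exact hne (Subtype.ext (h2.symm.trans h4))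
  · rintro ⟨⟨⟨k, u⟩, a⟩⟩ (⟨h1, h2⟩ | ⟨h1, h2⟩)
    · exact mem_iUnion.mpr ⟨⟨u, h2⟩, .inl ⟨h1, rfl⟩⟩
    · exact mem_iUnion.mpr ⟨⟨σ k u, (hf k u).trans h2⟩, .inr ⟨h1, rfl⟩⟩

lemma continuous_coord : Continuous fun a : CutHandle => (a.1.1 : ℝ) :=
  continuous_subtype_val.comp (continuous_fst.comp continuous_subtype_val)

/-- The complement of the cuts. -/
def interiorRegion : Region where
  lo _ := {a | 0 < (a.1.1 : ℝ) ∧ (a.1.1 : ℝ) < 1}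
  hi _ := ∅
  lo_open _ := (isOpen_lt continuous_const continuous_coord).inter
    (isOpen_lt continuous_coord continuous_const)
  hi_open _ := isOpen_empty
  disj _ _ _ := id
  rim_lo _ _ := Iff.rfl
  rim_hi _ _ _ := id
  seam_hi k θ := by simp [CutHandle.outgoing]
  seam_lo _ _ := id
  seam_iff k θ := by simp [CutHandle.incoming]

/-- A collar of the cut of the handle `k₀`. -/
def collarRegion (k₀ : Handle) : Region where
  lo k := {a | k = k₀ ∧ (a.1.1 : ℝ) < 1 / 4}
  hi k := {a | k = k₀ ∧ 3 / 4 < (a.1.1 : ℝ)}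
  lo_open _ := isOpen_const.and (isOpen_lt continuous_coord continuous_const)
  hi_open _ := isOpen_const.and (isOpen_lt continuous_const continuous_coord)
  disj k a h h' := by have := h.2; have := h'.2; linarith
  rim_lo a ha := by
    have h := abs_le.mp ((le_max_left _ _).trans ha.le)
    constructor <;> rintro ⟨-, h'⟩ <;> linarith [h.1]
  rim_hi a ha k := by
    have h := abs_le.mp ((le_max_left _ _).trans ha.le)
    rintro ⟨-, h'⟩; linarith [h.2]
  seam_hi k θ := by rintro ⟨-, h⟩; norm_num [CutHandle.outgoing] at h
  seam_lo k θ := by rintro ⟨-, h⟩; norm_num [CutHandle.incoming] at h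
  seam_iff k θ := by norm_num [CutHandle.incoming, CutHandle.outgoing]

/-- The map of surfaces induced by a surjective equivariant map is a covering map. -/
theorem isCoveringMap_map (f : W → V) (hf : ∀ k w, f (σ k w) = τ k (f w))
    (hs : Function.Surjective f) : IsCoveringMap (map f hf) := by
  rintro ⟨⟨⟨k, u⟩, a⟩⟩
  rcases lt_or_ge (a.1.1 : ℝ) (1 / 4) with h | h
  · exact (collarRegion k).isEvenlyCovered f hf hs u _ (.inl ⟨⟨rfl, h⟩, rfl⟩)
  rcases lt_or_ge (3 / 4) (a.1.1 : ℝ) with h' | h'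
  · exact (collarRegion k).isEvenlyCovered f hf hs (τ k u) _ (.inr ⟨⟨rfl, h'⟩, rfl⟩)
  · exact interiorRegion.isEvenlyCovered f hf hs u _ (.inl ⟨⟨by linarith, by linarith⟩, rfl⟩)

end Covering

end Surface

/-! ### The Schori solenoid -/

namespace Schori

/-- The indices of the `3 ^ ℓ` copies of the cut genus two surface which make up `X ℓ`; the
three copies of `X ℓ`, cut, that make up `X (ℓ + 1)` are numbered `0, 1, 2`. -/
def Copies : ℕ → Type
  | 0 => Unit
  | ℓ + 1 => Copies ℓ × Fin 3

/-- The identification of the three copies along the curve on the handle `k`: along `C ℓ` (on the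
handle `H`) the copies `0` and `1` are joined crosswise and the copy `2` is closed up; along
`D ℓ` (on the handle `F`) the copies `1` and `2` are joined crosswise and the copy `0` is
closed up. -/
def crossing : Handle → Equiv.Perm (Fin 3)
  | .H => Equiv.swap 0 1
  | .F => Equiv.swap 1 2

open Classical in
/-- Cut along the curve which leaves the copy `c`, take three copies, and reglue by `s`. -/
noncomputable def reglue {W : Type} (σ : Equiv.Perm W) (c : W) (s : Equiv.Perm (Fin 3)) :
    Equiv.Perm (W × Fin 3) where
  toFun x := (σ x.1, if x.1 = c then s x.2 else x.2)
  invFun x := (σ.symm x.1, if σ.symm x.1 = c then s.symm x.2 else x.2)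
  left_inv x := by ext <;> simp; split_ifs <;> simp
  right_inv x := by ext <;> simp; split_ifs <;> simp

variable (cut : ∀ ℓ, Handle → Copies ℓ)

/-- How the copies are glued in `X ℓ`. The curves `C ℓ`, `D ℓ` along which `X ℓ` is cut are
the sides `t = 1` of the cuts of the handles `H`, `F` in the copies `cut ℓ .H`, `cut ℓ .F`. -/
noncomputable def gluing : ∀ ℓ, Handle → Equiv.Perm (Copies ℓ)
  | 0 => fun _ => 1
  | ℓ + 1 => fun k => reglue (gluing ℓ k) (cut ℓ k) (crossing k)

/-- The surface `X ℓ`; `X 0` is a closed surface of genus two. -/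
def X (ℓ : ℕ) : Type := Surface (gluing cut ℓ)

noncomputable instance (ℓ : ℕ) : TopologicalSpace (X cut ℓ) :=
  inferInstanceAs (TopologicalSpace (Surface _))

/-- The three-to-one covering `X (ℓ + 1) → X ℓ`. -/
noncomputable def proj (ℓ : ℕ) : X cut (ℓ + 1) → X cut ℓ :=
  Surface.map (Prod.fst : Copies ℓ × Fin 3 → Copies ℓ) (fun _ _ => rfl)

/-- The next curve `C (ℓ + 1)` (resp. `D (ℓ + 1)`) is one of the lifts of `C 0` (resp. `D 0`)
that cross the handle of double length obtained by joining two of the three copies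
crosswise along `C ℓ` (resp. `D ℓ`). -/
def IsCutSequence : Prop :=
  ∀ ℓ k, (gluing cut (ℓ + 1) k).SameCycle ((cut ℓ k, 1) : Copies ℓ × Fin 3) (cut (ℓ + 1) k)

/-- The presentation of the Schori solenoid. -/
noncomputable def presentation : Presentation where
  M := X cut
  p := proj cut
  cov _ := Surface.isCoveringMap_map _ _ Prod.fst_surjective

end Schori

/-!
A loop which crosses the cut of the handle `k` once, from the side `t = 1` to the side `t = 0`,
leads from the copy `w` of the cut surface in `X ℓ` to the copy `gluing cut ℓ k w`. So the words in
`H` and `F` act on the copies at all levels at once, and each of them is realized by a loop.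

Let `N` be the length of the cycle of `gluing cut ℓ k` through the copy with the curve `cut ℓ k`.
The `N`-th power of the loop leads back to this copy and meets the curve exactly once, so that it
permutes the three copies over it by `crossing k`. All later curves lie over the handle which was
made longer. Hence the third copy, which was closed up, is never affected again and is fixed with
everything above it, while the two others are interchanged. The action on the copies is transitive,
so a conjugate of the word does the same over any other copy.
-/

namespace Presentation

variable {P : Presentation} {x₀ : P.M 0}

theorem exists_cylinder_subset {V : Set (P.Fiber x₀)} (hV : IsOpen V) {y : P.Fiber x₀}
    (hy : y ∈ V) : ∃ n, cylinder y n ⊆ V := by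
  obtain ⟨V', hV', rfl⟩ := isOpen_induced_iff.1 hV
  obtain ⟨V'', hV'', rfl⟩ := isOpen_induced_iff.1 hV'
  obtain ⟨I, u, hu, hI⟩ := isOpen_pi_iff.1 hV'' y.1.1 hy
  refine ⟨I.sup id, fun z hz => hI fun i hi => ?_⟩
  have hzi : z.1.1 i = y.1.1 i := coord_eq_of_le hz (Finset.le_sup (f := id) hi)
  rw [hzi]
  exact (hu i hi).2

theorem mem_chainGroup_iff {y : P.Fiber x₀} {n : ℕ} {g : FundamentalGroup (P.M 0) x₀} :
    g ∈ chainGroup y n ↔ holonomyMap g y ∈ cylinder y n := by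
  refine ⟨fun hg => holonomyMap_mem_cylinder y n hg rfl, fun hg => ?_⟩
  induction g using Quotient.inductionOn with | _ γ
  have hγ := γ.source.trans y.2.symm
  let δ : Path (y.1.1 n) (y.1.1 n) := ⟨(lift y.1 γ hγ n).1, (lift y.1 γ hγ n).2, hg⟩
  refine ⟨Quotient.mk _ δ, (FundamentalGroup.mapOfEq_apply _ _ _).trans ?_⟩
  exact congrArg (Quotient.mk _) (Path.ext (funext fun t => congrArg (· t) (q_lift y.1 γ hγ n)))

end Presentation

theorem not_isSQA_pseudoStarGroup {G T : Type*} [Group G] [TopologicalSpace T]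
    {Φ : G →* (T ≃ₜ T)} {g : G} {A : Set T} (hA : IsOpen A) (hne : A.Nonempty)
    (hfix : ∀ z ∈ A, Φ g z = z) {z : T} (hz : Φ g z ≠ z) : ¬ IsSQA (pseudoStarGroup Φ) :=
  fun hsqa => hz (hsqa (Φ g).toOpenPartialHomeomorph ⟨g, fun _ _ => rfl⟩ A hA hne
    (subset_univ A) hfix (mem_univ z))

theorem IsSQA.sectionHolonomy {P : Presentation} {x₀ : P.M 0} {V : Set (P.Fiber x₀)}
    (hsqa : IsSQA (inducedOn (pseudoStarGroup (Presentation.holonomy x₀)) V))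
    {y : P.Fiber x₀} {n : ℕ} (hn : Presentation.cylinder y n ⊆ V) :
    IsSQA (pseudoStarGroup (Presentation.sectionHolonomy y n)) := by
  rintro h ⟨g, hg⟩ U hU hne hUh hid z hz
  have hval := (Presentation.isOpen_cylinder y n).isOpenEmbedding_subtypeVal
  let φ := (Presentation.holonomy x₀ g).toOpenPartialHomeomorph.restrOpen
    (Subtype.val '' h.source) (hval.isOpenMap _ h.open_source)
  have hsource : φ.source = Subtype.val '' h.source := univ_inter _
  have hφ : ∀ w ∈ h.source, φ w = h w := fun w hw => congrArg Subtype.val (hg hw).symm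
  refine Subtype.ext ((hφ z hz).symm.trans (hsqa φ ⟨⟨g, fun _ _ => rfl⟩, ?_, ?_⟩
    (Subtype.val '' U) (hval.isOpenMap _ hU) (hne.image _) ?_ ?_ ?_))
  · rw [hsource]
    exact (Subtype.coe_image_subset _ _).trans hn
  · rw [← φ.image_source_eq_target, hsource]
    rintro _ ⟨_, ⟨w, hw, rfl⟩, rfl⟩
    rw [hφ w hw]
    exact hn (h w).2
  · rw [hsource]
    exact image_mono hUh
  · rintro _ ⟨w, hw, rfl⟩
    rw [hφ w (hUh hw), hid hw]
    rfl
  · rw [hsource]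
    exact mem_image_of_mem _ hz

/-! ### Regluing permutations -/

section Permutations

variable {ι : Type*} {W V : Type*}

theorem semiconj_freeGroup_lift {f : W → V} {σ : ι → Equiv.Perm W} {τ : ι → Equiv.Perm V}
    (h : ∀ k, Function.Semiconj f (σ k) (τ k)) (u : FreeGroup ι) :
    Function.Semiconj f (FreeGroup.lift σ u) (FreeGroup.lift τ u) := by
  induction u using FreeGroup.induction_on with
  | C1 => exact fun w => rfl
  | of k => simpa only [FreeGroup.lift_apply_of] using h k
  | inv_of k hk =>
    rw [map_inv, map_inv]
    exact hk.inverses_right (Equiv.right_inv _) (Equiv.left_inv _)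
  | mul u v hu hv =>
    rw [map_mul, map_mul]
    exact hu.comp_right hv

theorem sameCycle_map_of_semiconj {f : W → V} {σ : Equiv.Perm W} {τ : Equiv.Perm V}
    (h : Function.Semiconj f σ τ) {v w : W} (hvw : σ.SameCycle v w) :
    τ.SameCycle (f v) (f w) := by
  obtain ⟨n, rfl⟩ := hvw
  have hn := semiconj_freeGroup_lift (ι := Unit) (fun _ => h) (FreeGroup.of () ^ n)
  simp only [map_zpow, FreeGroup.lift_apply_of] at hn
  exact ⟨n, (hn v).symm⟩

theorem image_fiber_of_semiconj {f : W → V} {σ : Equiv.Perm W} {τ : Equiv.Perm V}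
    (h : Function.Semiconj f σ τ) (v : V) : σ '' {w | f w = v} = {w | f w = τ v} := by
  ext w
  obtain ⟨w, rfl⟩ := σ.surjective w
  simp [h w]

/-- A family of permutations acts transitively if every point is carried to every other one by
a product of members of the family and their inverses. -/
def ActsTransitively (σ : ι → Equiv.Perm W) : Prop :=
  ∀ v w, ∃ u, FreeGroup.lift σ u v = w

theorem actsTransitively_iff_forall_setoid {σ : ι → Equiv.Perm W} : ActsTransitively σ ↔
    ∀ r : Setoid W, (∀ k w, r w (σ k w)) → ∀ v w, r v w := by
  refine ⟨fun h r hr v w => ?_, fun h => ?_⟩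
  · obtain ⟨u, rfl⟩ := h v w
    have hmk : Function.Semiconj (Quotient.mk r) (FreeGroup.lift σ u)
        (FreeGroup.lift (fun _ : ι => (1 : Equiv.Perm (Quotient r))) u) :=
      semiconj_freeGroup_lift (fun k x => (Quotient.sound (hr k x)).symm) u
    have hone : FreeGroup.lift (fun _ : ι => (1 : Equiv.Perm (Quotient r))) = 1 := by
      ext; simp
    rw [hone] at hmk
    exact Quotient.exact (hmk v).symm
  · let orbits : Setoid W :=
      { r := fun v w => ∃ u, FreeGroup.lift σ u v = w
        iseqv.refl := fun v => ⟨1, rfl⟩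
        iseqv.symm := by
          rintro v _ ⟨u, rfl⟩
          exact ⟨u⁻¹, by simp⟩
        iseqv.trans := by
          rintro v _ _ ⟨u, rfl⟩ ⟨u', rfl⟩
          exact ⟨u' * u, by simp⟩ }
    exact h orbits fun k w => ⟨FreeGroup.of k, by simp⟩

-- If the class of `σ c` missed `c`, then `σ` would map it into itself, hence, by finiteness,
-- onto itself; but the preimage of `σ c` is `c`.
theorem setoid_rel_perm_apply_of_forall_ne [Finite W] (r : Setoid W) (σ : Equiv.Perm W) (c : W)
    (h : ∀ w, w ≠ c → r w (σ w)) (w : W) : r w (σ w) := by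
  by_cases hw : w = c
  · subst hw
    by_contra hc
    have hmaps : MapsTo σ {x | r (σ w) x} {x | r (σ w) x} := fun x hx =>
      r.trans hx (h x fun e => hc (r.symm (e ▸ hx)))
    obtain ⟨x, hx, hxw⟩ := ((toFinite _).injOn_iff_bijOn_of_mapsTo hmaps).1
      σ.injective.injOn |>.surjOn (r.refl (σ w))
    exact hc (r.symm (σ.injective hxw ▸ hx))
  · exact h w hw

end Permutations

namespace Schori

section Reglue

variable {W : Type} (σ : Equiv.Perm W) (c : W) (s : Equiv.Perm (Fin 3))

theorem reglue_apply_self (i : Fin 3) : reglue σ c s (c, i) = (σ c, s i) := by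
  simp [reglue]

theorem reglue_apply_of_ne {w : W} (hw : w ≠ c) (i : Fin 3) :
    reglue σ c s (w, i) = (σ w, i) := by
  simp [reglue, hw]

theorem semiconj_fst_reglue : Function.Semiconj Prod.fst (reglue σ c s) σ := fun _ => rfl

theorem reglue_pow_apply_of_forall_lt_ne {n : ℕ} {w : W} (h : ∀ j < n, (σ ^ j) w ≠ c)
    (i : Fin 3) : (reglue σ c s ^ n) (w, i) = ((σ ^ n) w, i) := by
  induction n with
  | zero => rfl
  | succ n ih =>
    rw [pow_succ', Equiv.Perm.mul_apply, ih fun j hj => h j (hj.trans n.lt_succ_self),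
      reglue_apply_of_ne _ _ _ (h n n.lt_succ_self), pow_succ', Equiv.Perm.mul_apply]

theorem reglue_pow_minimalPeriod_apply [Finite W] (i : Fin 3) :
    (reglue σ c s ^ Function.minimalPeriod σ c) (c, i) = (c, s i) := by
  obtain ⟨m, hm⟩ := Nat.exists_eq_succ_of_ne_zero (Function.minimalPeriod_pos_of_mem_periodicPts
    (σ.injective.mem_periodicPts c)).ne'
  have hne : ∀ j < m, (σ ^ j) (σ c) ≠ c := fun j hj hc =>
    Function.not_isPeriodicPt_of_pos_of_lt_minimalPeriod j.succ_ne_zero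
      (hm ▸ Nat.succ_lt_succ hj) (by
        rwa [← Equiv.Perm.mul_apply, ← pow_succ, ← Equiv.Perm.iterate_eq_pow] at hc)
  rw [hm, pow_succ, Equiv.Perm.mul_apply, reglue_apply_self,
    reglue_pow_apply_of_forall_lt_ne _ _ _ hne, ← Equiv.Perm.mul_apply, ← pow_succ,
    ← Nat.succ_eq_add_one, ← hm, ← Equiv.Perm.iterate_eq_pow, Function.iterate_minimalPeriod]

theorem semiconj_snd_eq_reglue {i : Fin 3} (hi : s i = i) :
    Function.Semiconj (fun x : W × Fin 3 => x.2 = i) (reglue σ c s) (1 : Equiv.Perm Prop) := by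
  rintro ⟨w, j⟩
  by_cases hw : w = c
  · subst hw
    simp [reglue_apply_self, (s.injective.eq_iff' hi : s j = i ↔ j = i)]
  · simp [reglue_apply_of_ne _ _ _ hw]

theorem ActsTransitively.reglue {ι : Type*} [Finite W] {σ : ι → Equiv.Perm W}
    {s : ι → Equiv.Perm (Fin 3)} (hσ : ActsTransitively σ) (hs : ActsTransitively s)
    (c : ι → W) : ActsTransitively fun k => Schori.reglue (σ k) (c k) (s k) := by
  refine actsTransitively_iff_forall_setoid.2 fun r hr => ?_
  have stay : ∀ k i w, w ≠ c k → r (w, i) (σ k w, i) := fun k i w hw =>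
    reglue_apply_of_ne (σ k) (c k) (s k) hw i ▸ hr k (w, i)
  have cross : ∀ k i, r (c k, i) (σ k (c k), s k i) := fun k i =>
    reglue_apply_self (σ k) (c k) (s k) i ▸ hr k (c k, i)
  have same_copy : ∀ i v w, r (v, i) (w, i) := fun i =>
    actsTransitively_iff_forall_setoid.1 hσ (r.comap (·, i)) fun k =>
      setoid_rel_perm_apply_of_forall_ne (r.comap (·, i)) (σ k) (c k) (stay k i)
  rintro ⟨v, i⟩ ⟨w, j⟩
  have change_copy : r (v, i) (v, j) :=
    actsTransitively_iff_forall_setoid.1 hs (r.comap (v, ·)) (fun k i =>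
      r.trans (same_copy i v (c k)) (r.trans (cross k i) (same_copy _ _ v))) i j
  exact r.trans change_copy (same_copy j v w)

end Reglue

/-! ### The monodromy of the tower -/

instance finite_copies : ∀ ℓ, Finite (Copies ℓ)
  | 0 => inferInstanceAs (Finite Unit)
  | ℓ + 1 =>
    have := finite_copies ℓ
    inferInstanceAs (Finite (Copies ℓ × Fin 3))

/-- The number of the copy of the cut surface in `X m` over which the copy with the given number
in `X (m + d)` lies: the digits after the `m`-th one are forgotten. -/
def truncate (m : ℕ) : ∀ d, Copies (m + d) → Copies m
  | 0, w => w
  | d + 1, w => truncate m d (w : Copies (m + d) × Fin 3).1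

section Monodromy

variable (cut : ∀ ℓ, Handle → Copies ℓ)

/-- The action on the copies in `X ℓ` of the words in the two letters `H` and `F`, each of which
stands for one crossing of the cut of the handle of that name. -/
noncomputable def monodromy (ℓ : ℕ) : FreeGroup Handle →* Equiv.Perm (Copies ℓ) :=
  FreeGroup.lift (gluing cut ℓ)

theorem monodromy_of (ℓ : ℕ) (k : Handle) :
    monodromy cut ℓ (FreeGroup.of k) = gluing cut ℓ k :=
  FreeGroup.lift_apply_of

theorem semiconj_truncate_gluing (m : ℕ) (k : Handle) : ∀ d,
    Function.Semiconj (truncate m d) (gluing cut (m + d) k) (gluing cut m k)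
  | 0 => fun _ => rfl
  | d + 1 => (semiconj_truncate_gluing m k d).comp_left (semiconj_fst_reglue _ _ _)

theorem semiconj_truncate_monodromy (m d : ℕ) (u : FreeGroup Handle) :
    Function.Semiconj (truncate m d) (monodromy cut (m + d) u) (monodromy cut m u) :=
  semiconj_freeGroup_lift (fun k => semiconj_truncate_gluing cut m k d) u

theorem actsTransitively_crossing : ActsTransitively crossing := by
  refine actsTransitively_iff_forall_setoid.2 fun r hr => ?_
  have rel_one : ∀ i, r i 1 := fun i => by
    fin_cases i
    exacts [hr .H 0, r.refl 1, hr .F 2]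
  exact fun i j => r.trans (rel_one i) (r.symm (rel_one j))

theorem actsTransitively_gluing : ∀ ℓ, ActsTransitively (gluing cut ℓ)
  | 0 => fun _ _ => ⟨1, rfl⟩
  | ℓ + 1 => ActsTransitively.reglue (actsTransitively_gluing ℓ) actsTransitively_crossing _

variable {cut}

theorem IsCutSequence.sameCycle_truncate_cut (hcut : IsCutSequence cut) (ℓ : ℕ) (k : Handle) :
    ∀ d, (gluing cut (ℓ + 1) k).SameCycle ((cut ℓ k, 1) : Copies ℓ × Fin 3)
      (truncate (ℓ + 1) d (cut (ℓ + 1 + d) k))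
  | 0 => hcut ℓ k
  | d + 1 => (hcut.sameCycle_truncate_cut ℓ k d).trans
      (sameCycle_map_of_semiconj (semiconj_truncate_gluing cut (ℓ + 1) k (d + 1))
        (hcut (ℓ + 1 + d) k))

theorem crossing_one_ne (k : Handle) : crossing k 1 ≠ 1 := by
  cases k <;> decide

-- All later curves lie over the handle which crosses the curve `cut ℓ k`, never over the copy
-- which is closed up along it.
theorem IsCutSequence.gluing_pow_ne_cut (hcut : IsCutSequence cut) {ℓ d : ℕ} {k : Handle}
    {i : Fin 3} (hi : crossing k i = i) {w : Copies (ℓ + 1 + d)}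
    (hw : truncate (ℓ + 1) d w = ((cut ℓ k, i) : Copies ℓ × Fin 3)) (n : ℕ) :
    (gluing cut (ℓ + 1 + d) k ^ n) w ≠ cut (ℓ + 1 + d) k := by
  intro hn
  have hcycle : (gluing cut (ℓ + 1) k).SameCycle (truncate (ℓ + 1) d w)
      (truncate (ℓ + 1) d (cut (ℓ + 1 + d) k)) :=
    sameCycle_map_of_semiconj (semiconj_truncate_gluing cut (ℓ + 1) k d) ⟨n, by simpa using hn⟩
  rw [hw] at hcycle
  have hdigit := Equiv.Perm.sameCycle_one.1 (sameCycle_map_of_semiconj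
    (semiconj_snd_eq_reglue (gluing cut ℓ k) (cut ℓ k) _ hi)
    (hcycle.trans (hcut.sameCycle_truncate_cut ℓ k d).symm))
  obtain rfl : (1 : Fin 3) = i := hdigit.mp rfl
  exact crossing_one_ne k hi

theorem IsCutSequence.gluing_pow_minimalPeriod_apply (hcut : IsCutSequence cut) (ℓ : ℕ)
    (k : Handle) {i : Fin 3} (hi : crossing k i = i) : ∀ (d : ℕ) (w : Copies (ℓ + 1 + d)),
    truncate (ℓ + 1) d w = ((cut ℓ k, i) : Copies ℓ × Fin 3) →
      (gluing cut (ℓ + 1 + d) k ^ Function.minimalPeriod (gluing cut ℓ k) (cut ℓ k)) w = w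
  | 0, _, rfl => (reglue_pow_minimalPeriod_apply _ _ _ i).trans (congrArg (Prod.mk _) hi)
  | d + 1, (v, j), hw =>
    (reglue_pow_apply_of_forall_lt_ne _ _ _ (fun n _ =>
      hcut.gluing_pow_ne_cut (w := v) hi hw n) j).trans
      (congrArg (·, j) (hcut.gluing_pow_minimalPeriod_apply ℓ k hi d v hw))

theorem IsCutSequence.exists_word_permuting_copies (hcut : IsCutSequence cut) (k : Handle)
    {n : ℕ} (v : Copies n) :
    ∃ (u : FreeGroup Handle) (w : Fin 3 → Copies (n + 1)),
      Function.Injective w ∧ (∀ i, truncate n 1 (w i) = v) ∧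
      (∀ i, monodromy cut (n + 1) u (w i) = w (crossing k i)) ∧
      ∀ i, crossing k i = i → ∀ d x, truncate (n + 1) d x = w i →
        monodromy cut (n + 1 + d) u x = x := by
  obtain ⟨t, ht⟩ : ∃ t, monodromy cut n t (cut n k) = v := actsTransitively_gluing cut n _ _
  let N := Function.minimalPeriod (gluing cut n k) (cut n k)
  have hconj : ∀ ℓ x, monodromy cut ℓ (t * FreeGroup.of k ^ N * t⁻¹) x =
      monodromy cut ℓ t ((gluing cut ℓ k ^ N) ((monodromy cut ℓ t).symm x)) := fun ℓ x => by
    rw [map_mul, map_mul, map_pow, map_inv, monodromy_of]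
    rfl
  let copy : Fin 3 → Copies (n + 1) := fun i => ((cut n k, i) : Copies n × Fin 3)
  refine ⟨t * FreeGroup.of k ^ N * t⁻¹, fun i => monodromy cut (n + 1) t (copy i),
    (Equiv.injective _).comp (Prod.mk_right_injective (cut n k)), fun i => ?_, fun i => ?_,
    fun i hi d x hx => ?_⟩
  · exact (semiconj_truncate_monodromy cut n 1 t (copy i)).trans ht
  · rw [hconj, Equiv.symm_apply_apply]
    exact congrArg _ (reglue_pow_minimalPeriod_apply _ _ _ i)
  · obtain ⟨x, rfl⟩ := (monodromy cut (n + 1 + d) t).surjective x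
    rw [semiconj_truncate_monodromy, EmbeddingLike.apply_eq_iff_eq] at hx
    rw [hconj, Equiv.symm_apply_apply, hcut.gluing_pow_minimalPeriod_apply n k hi d x hx]

end Monodromy

end Schori

/-! ### The cut handle is path connected -/

namespace CutHandle

theorem coe_half_of_abs_eq_one {ε : ℝ} (hε : |ε| = 1) :
    ((ε * (1 / 2) : ℝ) : UnitAddCircle) = ((1 / 2 : ℝ) : UnitAddCircle) := by
  rcases eq_or_eq_neg_of_abs_eq hε with rfl | rfl
  · rw [one_mul]
  · rw [← AddCircle.coe_add_period 1 (-1 * (1 / 2) : ℝ)]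
    norm_num

theorem exists_sign_mul_norm_eq (θ : UnitAddCircle) :
    ∃ ε : ℝ, |ε| = 1 ∧ ((ε * ‖θ‖ : ℝ) : UnitAddCircle) = θ := by
  obtain ⟨x, rfl⟩ := QuotientAddGroup.mk_surjective θ
  have hround : ((x - round x : ℝ) : UnitAddCircle) = x := by simp
  change ∃ ε : ℝ, |ε| = 1 ∧ ((ε * ‖(x : UnitAddCircle)‖ : ℝ) : UnitAddCircle) = x
  rw [UnitAddCircle.norm_eq]
  rcases abs_choice (x - round x) with h | h <;> rw [h]
  · exact ⟨1, abs_one, by rwa [one_mul]⟩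
  · exact ⟨-1, by simp, by rwa [neg_one_mul, neg_neg]⟩

theorem norm_coe_sign_mul {ε r : ℝ} (hε : |ε| = 1) (h0 : 0 ≤ r) (hr : r ≤ 1 / 2) :
    ‖((ε * r : ℝ) : UnitAddCircle)‖ = r := by
  have habs : |ε * r| = r := by rw [abs_mul, hε, one_mul, abs_of_nonneg h0]
  rw [(AddCircle.norm_coe_eq_abs_iff 1 one_ne_zero).2 (by rwa [habs, abs_one]), habs]

/-- The point opposite to the removed disc at the height `t`. -/
noncomputable def antipode (t : unitInterval) : CutHandle :=
  ⟨(t, ((1 / 2 : ℝ) : UnitAddCircle)), le_max_of_le_right (by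
    rw [(AddCircle.norm_coe_eq_abs_iff 1 one_ne_zero).2] <;> norm_num [abs_of_pos])⟩

theorem continuous_antipode : Continuous antipode :=
  Continuous.subtype_mk (by fun_prop) _

-- Move along the circle, away from the angle `0`, on the side on which the point lies.
theorem joined_antipode (a : CutHandle) : Joined a (antipode a.1.1) := by
  obtain ⟨⟨t, θ⟩, ha⟩ := a
  obtain ⟨ε, hε, hθ⟩ := exists_sign_mul_norm_eq θ
  have hnorm : ‖θ‖ ≤ 1 / 2 := by simpa using AddCircle.norm_le_half_period 1 one_ne_zero (x := θ)
  let r : ℝ → ℝ := fun s => (1 - s) * ‖θ‖ + s * (1 / 2)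
  refine JoinedIn.joined_subtype (JoinedIn.ofLine
    (f := fun s => (t, ((ε * r s : ℝ) : UnitAddCircle))) ?_ ?_ ?_ ?_)
  · exact (continuous_const.prodMk ((AddCircle.continuous_mk' 1).comp
      (by fun_prop))).continuousOn
  · simp [r, hθ]
  · simpa [r, antipode] using coe_half_of_abs_eq_one hε
  · rintro _ ⟨s, ⟨h0, h1⟩, rfl⟩
    have hle : ‖θ‖ ≤ r s := by simp only [r]; nlinarith
    have hr : r s ≤ 1 / 2 := by simp only [r]; nlinarith
    change 1 / 4 ≤ max |(t : ℝ) - 1 / 2| ‖((ε * r s : ℝ) : UnitAddCircle)‖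
    rw [norm_coe_sign_mul hε ((norm_nonneg θ).trans hle) hr]
    exact ha.trans (max_le_max_left _ hle)

instance : PathConnectedSpace CutHandle where
  nonempty := ⟨outgoing 0⟩
  joined a b :=
    have : PathConnectedSpace unitInterval := isPathConnected_iff_pathConnectedSpace.1
      ((convex_Icc (0 : ℝ) 1).isPathConnected ⟨0, left_mem_Icc.2 zero_le_one⟩)
    (joined_antipode a).trans (((PathConnectedSpace.joined a.1.1 b.1.1).map
      continuous_antipode).trans (joined_antipode b).symm)

theorem exists_onRim : ∃ a : CutHandle, a.OnRim := by
  have h : max |(1 / 2 : ℝ) - 1 / 2| ‖((1 / 4 : ℝ) : UnitAddCircle)‖ = 1 / 4 := by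
    rw [(AddCircle.norm_coe_eq_abs_iff 1 one_ne_zero).2] <;> norm_num [abs_of_pos]
  exact ⟨⟨(⟨1 / 2, by norm_num, by norm_num⟩, ((1 / 4 : ℝ) : UnitAddCircle)), h.ge⟩, h⟩

theorem OnRim.ne_one {a : CutHandle} (ha : a.OnRim) : a.1.1 ≠ 1 := by
  intro h
  have := (le_max_left _ _).trans ha.le
  rw [h] at this
  norm_num [abs_of_pos] at this

theorem eq_outgoing {a : CutHandle} (ha : a.1.1 = 1) : a = outgoing a.1.2 :=
  Subtype.ext (Prod.ext ha rfl)

end CutHandle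

/-! ### Labels of the points of a glued surface -/

namespace Surface

variable {W V : Type} {σ : Handle → Equiv.Perm W} {τ : Handle → Equiv.Perm V}

open Classical in
/-- The index of the copy in which a point lies. A point of a seam lies in two copies; it gets the
index of the one in which it is incoming. The label is therefore not continuous at the seams. -/
noncomputable def label : Surface σ → W :=
  Quot.lift (fun x => if x.2.1.1 = 1 then σ x.1.1 x.1.2 else x.1.2) (by
    rintro _ _ (⟨w, a, ha⟩ | ⟨k, w, θ⟩)
    · simp only [ha.ne_one, if_false]
    · simp [CutHandle.outgoing, CutHandle.incoming])

open Classical in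
/-- The point with the label `w` in the same position in its copy as a given point. -/
noncomputable def relabel (w : W) : Surface τ → Surface σ :=
  Quot.lift (fun x => Quot.mk _
    ⟨(x.1.1, if x.2.1.1 = 1 then (σ x.1.1).symm w else w), x.2⟩) (by
    rintro _ _ (⟨v, a, ha⟩ | ⟨k, v, θ⟩)
    · simp only [ha.ne_one, if_false]
      exact Quot.sound (.rim w a ha)
    · refine Quot.sound ?_
      simpa [CutHandle.outgoing, CutHandle.incoming] using
        Glue.seam (σ := σ) k ((σ k).symm w) θ)

theorem label_map (f : W → V) (hf : ∀ k w, f (σ k w) = τ k (f w)) (z : Surface σ) :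
    label (map f hf z) = f (label z) := by
  obtain ⟨⟨⟨k, w⟩, a⟩⟩ := z
  change (if a.1.1 = 1 then τ k (f w) else f w) = f (if a.1.1 = 1 then σ k w else w)
  rw [apply_ite f, hf]

theorem relabel_label_map (f : W → V) (hf : ∀ k w, f (σ k w) = τ k (f w)) (z : Surface σ) :
    relabel (label z) (map f hf z) = z := by
  obtain ⟨⟨⟨k, w⟩, a⟩⟩ := z
  change (Quot.mk _ ⟨(k, if a.1.1 = 1 then (σ k).symm (if a.1.1 = 1 then σ k w else w) else
    if a.1.1 = 1 then σ k w else w), a⟩ : Surface σ) = Quot.mk _ ⟨(k, w), a⟩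
  split_ifs <;> simp

theorem eq_of_map_eq_of_label_eq (f : W → V) (hf : ∀ k w, f (σ k w) = τ k (f w))
    {z z' : Surface σ} (hmap : map f hf z = map f hf z') (hlabel : label z = label z') :
    z = z' := by
  rw [← relabel_label_map f hf z, hmap, hlabel, relabel_label_map]

theorem exists_eq_mk_of_ne_one (z : Surface σ) :
    ∃ (k : Handle) (w : W) (a : CutHandle), a.1.1 ≠ 1 ∧ z = Quot.mk _ ⟨(k, w), a⟩ := by
  obtain ⟨⟨⟨k, w⟩, a⟩⟩ := z
  by_cases ha : a.1.1 = 1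
  · refine ⟨k, σ k w, CutHandle.incoming a.1.2, by simp [CutHandle.incoming], ?_⟩
    rw [CutHandle.eq_outgoing ha]
    exact Quot.sound (.seam k w _)
  · exact ⟨k, w, a, ha, rfl⟩

end Surface

namespace Schori

open Presentation

variable (cut : ∀ ℓ, Handle → Copies ℓ)

/-! ### Lifting words in the handles to loops -/

/-- The number of the copy of the cut surface in which a point of `X ℓ` lies, a point of a curve
along which copies are glued being counted in the copy that it enters. -/
noncomputable def label (ℓ : ℕ) : (presentation cut).M ℓ → Copies ℓ :=
  Surface.label (σ := gluing cut ℓ)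

theorem label_proj (ℓ : ℕ) (z : (presentation cut).M (ℓ + 1)) :
    label cut ℓ ((presentation cut).p ℓ z) = (label cut (ℓ + 1) z : Copies ℓ × Fin 3).1 :=
  Surface.label_map Prod.fst (fun _ _ => rfl) z

theorem eq_of_q_eq_of_label_eq : ∀ {ℓ : ℕ} {z z' : (presentation cut).M ℓ},
    (presentation cut).q ℓ z = (presentation cut).q ℓ z' → label cut ℓ z = label cut ℓ z' → z = z'
  | 0, _, _, hq, _ => hq
  | ℓ + 1, z, z', hq, hlabel =>
    have hproj : (presentation cut).p ℓ z = (presentation cut).p ℓ z' :=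
      eq_of_q_eq_of_label_eq hq (by rw [label_proj, label_proj, hlabel])
    Surface.eq_of_map_eq_of_label_eq (σ := gluing cut (ℓ + 1)) (τ := gluing cut ℓ) Prod.fst
      (fun _ _ => rfl) hproj hlabel

theorem truncate_label (z : (presentation cut).Solenoid) (m : ℕ) : ∀ d,
    truncate m d (label cut (m + d) (z.1 (m + d))) = label cut m (z.1 m)
  | 0 => rfl
  | d + 1 => by
    rw [← truncate_label z m d, ← z.2 (m + d), label_proj]
    rfl

/-- The point `a` of the cut handle `k` of the copy `w` in `X ℓ`. -/
def point (ℓ : ℕ) (k : Handle) (w : Copies ℓ) (a : CutHandle) : (presentation cut).M ℓ :=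
  Quot.mk _ ⟨(k, w), a⟩

theorem q_point : ∀ (ℓ : ℕ) (k : Handle) (w : Copies ℓ) (a : CutHandle),
    (presentation cut).q ℓ (point cut ℓ k w a) = point cut 0 k () a
  | 0, _, _, _ => rfl
  | ℓ + 1, k, w, a => q_point ℓ k (w : Copies ℓ × Fin 3).1 a

theorem continuous_point (ℓ : ℕ) (k : Handle) (w : Copies ℓ) : Continuous (point cut ℓ k w) :=
  continuous_quot_mk.comp continuous_sigmaMk

variable {cut}

theorem label_point_of_ne_one {ℓ : ℕ} {k : Handle} {w : Copies ℓ} {a : CutHandle}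
    (ha : a.1.1 ≠ 1) : label cut ℓ (point cut ℓ k w a) = w :=
  if_neg ha

theorem label_point_outgoing (ℓ : ℕ) (k : Handle) (w : Copies ℓ) (θ : UnitAddCircle) :
    label cut ℓ (point cut ℓ k w (CutHandle.outgoing θ)) = gluing cut ℓ k w :=
  if_pos rfl

variable (cut) in
/-- Two points of `X 0` are joined by a word if there is a path between them whose lifts to each
`X ℓ` change the labels of points as the word does. -/
def JoinedByWord (u : FreeGroup Handle) (x y : (presentation cut).M 0) : Prop :=
  ∃ γ : Path x y, ∀ ℓ w, ∃ (a b : (presentation cut).M ℓ) (Γ : Path a b),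
    label cut ℓ a = w ∧ label cut ℓ b = monodromy cut ℓ u w ∧
      ∀ t, (presentation cut).q ℓ (Γ t) = γ t

namespace JoinedByWord

variable {u v : FreeGroup Handle} {x y z : (presentation cut).M 0}

theorem trans (h : JoinedByWord cut u x y) (h' : JoinedByWord cut v y z) :
    JoinedByWord cut (v * u) x z := by
  obtain ⟨γ, hγ⟩ := h
  obtain ⟨γ', hγ'⟩ := h'
  refine ⟨γ.trans γ', fun ℓ w => ?_⟩
  obtain ⟨a, b, Γ, ha, hb, hΓ⟩ := hγ ℓ w
  obtain ⟨b', c, Γ', hb', hc, hΓ'⟩ := hγ' ℓ (monodromy cut ℓ u w)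
  obtain rfl : b = b' := by
    refine eq_of_q_eq_of_label_eq cut ?_ (hb.trans hb'.symm)
    rw [← Γ.target, hΓ, γ.target, ← Γ'.source, hΓ', γ'.source]
  refine ⟨a, c, Γ.trans Γ', ha, by rw [hc, map_mul, Equiv.Perm.mul_apply], fun t => ?_⟩
  rw [Path.trans_apply, Path.trans_apply]
  split_ifs
  · exact hΓ _
  · exact hΓ' _

theorem symm (h : JoinedByWord cut u x y) : JoinedByWord cut u⁻¹ y x := by
  obtain ⟨γ, hγ⟩ := h
  refine ⟨γ.symm, fun ℓ w => ?_⟩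
  obtain ⟨a, b, Γ, ha, hb, hΓ⟩ := hγ ℓ (monodromy cut ℓ u⁻¹ w)
  refine ⟨b, a, Γ.symm, ?_, ha, fun t => hΓ _⟩
  rw [hb, map_inv]
  exact (monodromy cut ℓ u).apply_symm_apply w

end JoinedByWord

theorem joinedByWord_point {u : FreeGroup Handle} {k : Handle} {a b : CutHandle}
    (ha : a.1.1 ≠ 1) (hb : ∀ ℓ w, label cut ℓ (point cut ℓ k w b) = monodromy cut ℓ u w) :
    JoinedByWord cut u (point cut 0 k () a) (point cut 0 k () b) :=
  let δ := (PathConnectedSpace.joined a b).somePath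
  ⟨δ.map (continuous_point cut 0 k ()), fun ℓ w =>
    ⟨_, _, δ.map (continuous_point cut ℓ k w), label_point_of_ne_one ha, hb ℓ w,
      fun t => q_point cut ℓ k w (δ t)⟩⟩

theorem joinedByWord_one_point {k : Handle} {a b : CutHandle} (ha : a.1.1 ≠ 1) (hb : b.1.1 ≠ 1) :
    JoinedByWord cut 1 (point cut 0 k () a) (point cut 0 k () b) :=
  joinedByWord_point ha fun ℓ w => by rw [label_point_of_ne_one hb, map_one]; rfl

theorem joinedByWord_one (x y : (presentation cut).M 0) : JoinedByWord cut 1 x y := by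
  obtain ⟨r, hr⟩ := CutHandle.exists_onRim
  have join_rim : ∀ z, JoinedByWord cut 1 z (point cut 0 .F () r) := fun z => by
    obtain ⟨k, w, a, ha, rfl⟩ := Surface.exists_eq_mk_of_ne_one (σ := gluing cut 0) z
    have h := joinedByWord_one_point (cut := cut) (k := k) ha hr.ne_one
    cases k
    · rwa [show point cut 0 .H () r = point cut 0 .F () r from Quot.sound (.rim () r hr)] at h
    · exact h
  simpa using (join_rim x).trans (join_rim y).symm

theorem joinedByWord_of (k : Handle) (x : (presentation cut).M 0) :
    JoinedByWord cut (FreeGroup.of k) x x := by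
  have hin : (CutHandle.incoming 0).1.1 ≠ 1 := zero_ne_one
  have hcross : JoinedByWord cut (FreeGroup.of k) (point cut 0 k () (CutHandle.incoming 0))
      (point cut 0 k () (CutHandle.outgoing 0)) :=
    joinedByWord_point hin fun ℓ w => by rw [label_point_outgoing, monodromy_of]
  simpa using ((joinedByWord_one x _).trans hcross).trans (joinedByWord_one _ x)

theorem joinedByWord_self (u : FreeGroup Handle) (x : (presentation cut).M 0) :
    JoinedByWord cut u x x := by
  induction u using FreeGroup.induction_on with
  | C1 => exact joinedByWord_one x x
  | of k => exact joinedByWord_of k x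
  | inv_of k hk => exact hk.symm
  | mul u v hu hv => exact hv.trans hu

theorem exists_holonomyMap_label (x₀ : (presentation cut).M 0) (u : FreeGroup Handle) :
    ∃ g : FundamentalGroup ((presentation cut).M 0) x₀, ∀ z ℓ,
      label cut ℓ ((holonomyMap g z).1.1 ℓ) = monodromy cut ℓ u (label cut ℓ (z.1.1 ℓ)) := by
  obtain ⟨γ, hγ⟩ := joinedByWord_self u x₀
  refine ⟨Quotient.mk _ γ, fun z ℓ => ?_⟩
  obtain ⟨a, b, Γ, ha, hb, hΓ⟩ := hγ ℓ (label cut ℓ (z.1.1 ℓ))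
  have haz : a = z.1.1 ℓ := by
    refine eq_of_q_eq_of_label_eq cut ?_ ha
    rw [q_apply, z.2, ← Γ.source, hΓ, γ.source]
  have hlift : (lift z.1 γ (γ.source.trans z.2.symm) ℓ).1 = Γ :=
    lift_unique z.1 γ _ ℓ Γ (ContinuousMap.ext hΓ) (Γ.source.trans haz)
  exact (congrArg (label cut ℓ) ((congrArg (· 1) hlift).trans Γ.target)).trans hb

/-! ### The failure of strong quasi-analyticity -/

section Holonomy

variable {x₀ : (presentation cut).M 0}

theorem isLocallyConstant_label (ℓ : ℕ) :
    IsLocallyConstant fun z : (presentation cut).Fiber x₀ => label cut ℓ (z.1.1 ℓ) :=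
  (IsLocallyConstant.iff_exists_open _).2 fun z =>
    ⟨cylinder z ℓ, isOpen_cylinder z ℓ, rfl, fun _ hz => congrArg (label cut ℓ) hz⟩

theorem eq_of_label_eq {z z' : (presentation cut).Fiber x₀} {ℓ : ℕ}
    (h : label cut ℓ (z.1.1 ℓ) = label cut ℓ (z'.1.1 ℓ)) : z.1.1 ℓ = z'.1.1 ℓ :=
  eq_of_q_eq_of_label_eq cut (by rw [q_apply, q_apply, z.2, z'.2]) h

theorem mem_cylinder_iff_label {y z : (presentation cut).Fiber x₀} {n : ℕ} :
    z ∈ cylinder y n ↔ label cut n (z.1.1 n) = label cut n (y.1.1 n) :=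
  ⟨congrArg (label cut n), eq_of_label_eq⟩

theorem holonomyMap_eq_self_of_monodromy {u : FreeGroup Handle} {g : FundamentalGroup _ x₀}
    (hg : ∀ z ℓ, label cut ℓ ((holonomyMap g z).1.1 ℓ) = monodromy cut ℓ u (label cut ℓ (z.1.1 ℓ)))
    {n : ℕ} {z : (presentation cut).Fiber x₀}
    (hz : ∀ d x, truncate n d x = label cut n (z.1.1 n) → monodromy cut (n + d) u x = x) :
    holonomyMap g z = z := by
  refine Subtype.ext (Subtype.ext (funext fun ℓ => coord_eq_of_le (ℓ := n + ℓ) ?_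
    (Nat.le_add_left ℓ n)))
  exact eq_of_label_eq ((hg z _).trans (hz ℓ _ (truncate_label cut z.1 n ℓ)))

theorem surjective_label [hne : Nonempty ((presentation cut).Fiber x₀)] (ℓ : ℕ) :
    Function.Surjective fun z : (presentation cut).Fiber x₀ => label cut ℓ (z.1.1 ℓ) := by
  obtain ⟨y⟩ := hne
  intro w
  obtain ⟨u, hu⟩ := actsTransitively_gluing cut ℓ (label cut ℓ (y.1.1 ℓ)) w
  obtain ⟨g, hg⟩ := exists_holonomyMap_label x₀ u
  exact ⟨holonomyMap g y, (hg y ℓ).trans hu⟩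

theorem IsCutSequence.exists_sectionHolonomy_permuting (hcut : IsCutSequence cut) (k : Handle)
    (y : (presentation cut).Fiber x₀) (n : ℕ) :
    ∃ (g : chainGroup y n) (E : Fin 3 → Set (cylinder y n)),
      (∀ i, IsClopen (E i) ∧ (E i).Nonempty) ∧ Pairwise (Function.onFun Disjoint E) ∧
      (∀ i, sectionHolonomy y n g '' E i = E (crossing k i)) ∧
      ∀ i, crossing k i = i → ∀ z ∈ E i, sectionHolonomy y n g z = z := by
  obtain ⟨u, w, hinj, hover, hperm, hfix⟩ :=
    hcut.exists_word_permuting_copies k (label cut n (y.1.1 n))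
  obtain ⟨g, hg⟩ := exists_holonomyMap_label x₀ u
  have hmem : g ∈ chainGroup y n := by
    rw [mem_chainGroup_iff, mem_cylinder_iff_label, hg, ← hover 0,
      ← semiconj_truncate_monodromy, hperm, hover, hover]
  let f : cylinder y n → Copies (n + 1) := fun z => label cut (n + 1) (z.1.1.1 (n + 1))
  have hf : IsLocallyConstant f :=
    (isLocallyConstant_label (n + 1)).comp_continuous continuous_subtype_val
  have hsemiconj : Function.Semiconj f (sectionHolonomy y n ⟨g, hmem⟩).toEquiv
      (monodromy cut (n + 1) u) := fun z => hg z.1 (n + 1)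
  refine ⟨⟨g, hmem⟩, fun i => {z | f z = w i}, fun i => ⟨hf.isClopen_fiber (w i), ?_⟩,
    fun i j hij => ?_, fun i => ?_, fun i hi z hz => ?_⟩
  · have : Nonempty ((presentation cut).Fiber x₀) := ⟨y⟩
    obtain ⟨z, hz⟩ : ∃ z : (presentation cut).Fiber x₀, label cut (n + 1) (z.1.1 (n + 1)) = w i :=
      surjective_label (n + 1) (w i)
    refine ⟨⟨z, mem_cylinder_iff_label.2 ?_⟩, hz⟩
    rw [← truncate_label cut z.1 n 1, hz, hover]
  · exact disjoint_left.2 fun z hi hj => hij (hinj (hi.symm.trans hj))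
  · exact (image_fiber_of_semiconj hsemiconj (w i)).trans (by rw [hperm])
  · exact Subtype.ext (holonomyMap_eq_self_of_monodromy hg fun d x hx => hfix i hi d x (hx.trans hz))

theorem IsCutSequence.not_isSQA_sectionHolonomy (hcut : IsCutSequence cut)
    (y : (presentation cut).Fiber x₀) (n : ℕ) :
    ¬ IsSQA (pseudoStarGroup (sectionHolonomy y n)) := by
  obtain ⟨g, E, hE, hdisjoint, hperm, hfix⟩ := hcut.exists_sectionHolonomy_permuting .H y n
  obtain ⟨z, hz⟩ := (hE 0).2
  have hgz : sectionHolonomy y n g z ∈ E 1 := hperm 0 ▸ mem_image_of_mem _ hz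
  exact not_isSQA_pseudoStarGroup (hE 2).1.isOpen (hE 2).2 (hfix 2 (by decide))
    ((hdisjoint zero_ne_one).ne_of_mem hz hgz).symm

theorem IsCutSequence.not_isSQA_inducedOn (hcut : IsCutSequence cut)
    {V : Set ((presentation cut).Fiber x₀)} (hV : IsOpen V) (hne : V.Nonempty) :
    ¬ IsSQA (inducedOn (pseudoStarGroup (holonomy x₀)) V) := by
  obtain ⟨y, hy⟩ := hne
  obtain ⟨n, hn⟩ := exists_cylinder_subset hV hy
  exact fun hsqa => hcut.not_isSQA_sectionHolonomy y n (hsqa.sectionHolonomy hn)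

end Holonomy

end Schori

theorem mainTheorem7 (cut : ∀ ℓ, Handle → Schori.Copies ℓ) (hcut : Schori.IsCutSequence cut)
    (x₀ : (Schori.presentation cut).M 0) :
    (∀ (y : (Schori.presentation cut).Fiber x₀) (n : ℕ),
      ¬ IsSQA (pseudoStarGroup (Presentation.sectionHolonomy y n)) ∧
      ∃ (g : Presentation.chainGroup y n) (A B C : Set (Presentation.cylinder y n)),
        (IsClopen A ∧ A.Nonempty) ∧ (IsClopen B ∧ B.Nonempty) ∧ (IsClopen C ∧ C.Nonempty) ∧
        Disjoint A B ∧ Disjoint A C ∧ Disjoint B C ∧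
        (∀ z ∈ A, Presentation.sectionHolonomy y n g z = z) ∧
        Presentation.sectionHolonomy y n g '' B = C ∧
        Presentation.sectionHolonomy y n g '' C = B) ∧
    ∀ V : Set ((Schori.presentation cut).Fiber x₀), IsClopen V → V.Nonempty →
      ¬ IsSQA (inducedOn (pseudoStarGroup (Presentation.holonomy x₀)) V) := by
  refine ⟨fun y n => ⟨hcut.not_isSQA_sectionHolonomy y n, ?_⟩,
    fun V hV hne => hcut.not_isSQA_inducedOn hV.isOpen hne⟩
  obtain ⟨g, E, hE, hdisjoint, hperm, hfix⟩ := hcut.exists_sectionHolonomy_permuting .H y n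
  exact ⟨g, E 2, E 0, E 1, hE 2, hE 0, hE 1, hdisjoint (by decide), hdisjoint (by decide),
    hdisjoint (by decide), hfix 2 (by decide), hperm 0, hperm 1⟩
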